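/- Let $d\ge 2$, let $H_1,\dots,H_d$ be Hilbert spaces (all real or all complex), and let $\mathbf H=H_1\otimes\cdots\otimes H_d$ be their Hilbert space tensor product (the completion of the algebraic tensor product for the induced inner product). Fix $t\subset\{1,\dots,d\}$ with $0<|t|<d$ and put $t^c=\{1,\dots,d\}\setminus t$, so that $\mathbf H\cong\mathbf H_t\otimes\mathbf H_{t^c}$ with $\mathbf H_t=\bigotimes_{\mu\in t}H_\mu$ and $\mathbf H_{t^c}=\bigotimes_{\mu\notin t}H_\mu$. The $t$-rank $\mathrm{rank}^{(t)}(\mathbf v)\in\mathbb N\cup\{\infty\}$ of $\mathbf v\in\mathbf H$ is the rank of the Hilbert–Schmidt operator between $\mathbf H_{t^c}$ and $\mathbf H_t$ associated with $\mathbf v$, and $$\tau^{(t)}_r(\mathbf u)=\inf\{\|\mathbf u-\mathbf v\| : \mathrm{rank}^{(t)}(\mathbf v)\le r\}.$$ Let $\mathbf A$ be a bounded self-adjoint operator on $\mathbf H$ with $$\mathbf A=\sum_{i=1}^{r_{\mathbf A}}A_i^{(t)}\otimes A_i^{(t^c)},\qquad r_{\mathbf A}\ge 1,$$ where $A_i^{(t)}$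 and $A_i^{(t^c)}$ are bounded operators on $\mathbf H_t$ and $\mathbf H_{t^c}$. Let $\lambda_1<\lambda_2<\Gamma$ be real numbers such that $\lambda_1\|\mathbf v\|^2\le\langle\mathbf v,\mathbf A\mathbf v\rangle\le\Gamma\|\mathbf v\|^2$ for all $\mathbf v\in\mathbf H$, such that $\lambda_1$ is a simple eigenvalue of $\mathbf A$ (its eigenspace is one-dimensional), and such that the rest of the spectrum of $\mathbf A$ is contained in $[\lambda_2,\Gamma]$. Let $\mathbf u\neq 0$ be an eigenvector, $\mathbf A\mathbf u=\lambda_1\mathbf u$. Put $$\delta=\lambda_2-\lambda_1,\qquad \Delta=\frac{\delta}{\Gamma-\lambda_1},\qquad q=\frac{1-\Delta}{1+\Delta}.$$ Then there are $\mathbf v\in\mathbf H$ with $\mathrm{rank}^{(t)}(\mathbf v)\le 1$ and $\langle\mathbf v-\mathbf u,\mathbf u\rangle=0$, and with $$\pi^{(t)}_1(\mathbf u)=\inf\{\|\mathbf v-\mathbf u\| : \mathrm{rank}^{(t)}(\mathbf v)\le 1,\ \langle\mathbf v-\mathbf u,\mathbf u\rangle=0\}$$ one has, for every integer $r\ge 1$,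 $$\tau_r^{(t)}(\mathbf u)\le\frac{\pi^{(t)}_1(\mathbf u)}{q}\left(\frac1r\right)^{\left|\frac{\ln q}{\ln R}\right|}\qquad\text{with } R=r_{\mathbf A}+1.$$ If, in addition, $A_i^{(t)}$ or $A_i^{(t^c)}$ is the identity for some $i$, and $r_{\mathbf A}\ge 2$, then the same estimate holds for every integer $r\ge1$ with $R=r_{\mathbf A}$. -/

import Mathlib

set_option linter.unusedSectionVars false

section AlgebraicTensor

universe u v w

variable {𝕜 : Type u} [RCLike 𝕜] {ι : Type v} [Fintype ι]
variable {E : ι → Type w} [∀ i, NormedAddCommGroup (E i)] [∀ i, InnerProductSpace 𝕜 (E i)]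

/-- The algebraic tensor product of the spaces `E i`, as a type of its own, so that it carries
the inner product defined below and not one of Mathlib's cross norms. -/
def AlgTensor (𝕜 : Type u) [RCLike 𝕜] {ι : Type v} (E : ι → Type w)
    [∀ i, NormedAddCommGroup (E i)] [∀ i, InnerProductSpace 𝕜 (E i)] : Type (max u v w) :=
  PiTensorProduct 𝕜 E

noncomputable instance AlgTensor.instAddCommGroup : AddCommGroup (AlgTensor 𝕜 E) :=
  inferInstanceAs (AddCommGroup (PiTensorProduct 𝕜 E))

noncomputable instance AlgTensor.instModule : Module 𝕜 (AlgTensor 𝕜 E) :=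
  inferInstanceAs (Module 𝕜 (PiTensorProduct 𝕜 E))

/-- The elementary tensors `⨂ i, x i` in the algebraic tensor product. -/
noncomputable def AlgTensor.pure : MultilinearMap 𝕜 E (AlgTensor 𝕜 E) :=
  PiTensorProduct.tprod 𝕜

/-- The linear form `y ↦ ∏ i, ⟪x i, y i⟫` (on elementary tensors). -/
noncomputable def AlgTensor.innerPure (x : ∀ i, E i) : AlgTensor 𝕜 E →ₗ[𝕜] 𝕜 :=
  PiTensorProduct.lift
    ((MultilinearMap.mkPiAlgebra 𝕜 ι 𝕜).compLinearMap fun i => innerₛₗ 𝕜 (x i))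

theorem AlgTensor.innerPure_pure (x y : ∀ i, E i) :
    AlgTensor.innerPure x (AlgTensor.pure (𝕜 := 𝕜) y) = ∏ i, inner 𝕜 (x i) (y i) := by
  unfold AlgTensor.innerPure AlgTensor.pure
  erw [PiTensorProduct.lift.tprod]
  simp

theorem AlgTensor.hom_ext {M : Type*} [AddCommGroup M] [Module 𝕜 M]
    {f g : AlgTensor 𝕜 E →ₗ[𝕜] M}
    (h : ∀ x, f (AlgTensor.pure x) = g (AlgTensor.pure x)) : f = g :=
  PiTensorProduct.ext (MultilinearMap.ext h)

theorem AlgTensor.span_pure :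
    Submodule.span 𝕜 (Set.range (AlgTensor.pure : (∀ i, E i) → AlgTensor 𝕜 E)) = ⊤ :=
  PiTensorProduct.span_tprod_eq_top

theorem AlgTensor.innerPure_update_add [DecidableEq ι] (x : ∀ i, E i) (i : ι) (a b : E i) :
    AlgTensor.innerPure (𝕜 := 𝕜) (Function.update x i (a + b)) =
      AlgTensor.innerPure (Function.update x i a) + AlgTensor.innerPure (Function.update x i b) := by
  refine AlgTensor.hom_ext fun y => ?_
  simp only [LinearMap.add_apply, AlgTensor.innerPure_pure]
  rw [← Finset.mul_prod_erase _ _ (Finset.mem_univ i), ← Finset.mul_prod_erase _ _ (Finset.mem_univ i),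
    ← Finset.mul_prod_erase _ _ (Finset.mem_univ i)]
  have key : ∀ c : E i, ∏ j ∈ Finset.univ.erase i, inner 𝕜 (Function.update x i c j) (y j) =
      ∏ j ∈ Finset.univ.erase i, inner 𝕜 (x j) (y j) := fun c =>
    Finset.prod_congr rfl fun j hj => by
      rw [Function.update_of_ne (Finset.ne_of_mem_erase hj)]
  simp only [key, Function.update_self, inner_add_left, add_mul]

theorem AlgTensor.innerPure_update_smul [DecidableEq ι] (x : ∀ i, E i) (i : ι) (c : 𝕜) (a : E i) :
    AlgTensor.innerPure (𝕜 := 𝕜) (Function.update x i (c • a)) =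
      (starRingEnd 𝕜 c) • AlgTensor.innerPure (Function.update x i a) := by
  refine AlgTensor.hom_ext fun y => ?_
  simp only [LinearMap.smul_apply, AlgTensor.innerPure_pure]
  rw [← Finset.mul_prod_erase _ _ (Finset.mem_univ i), ← Finset.mul_prod_erase _ _ (Finset.mem_univ i)]
  have key : ∀ c : E i, ∏ j ∈ Finset.univ.erase i, inner 𝕜 (Function.update x i c j) (y j) =
      ∏ j ∈ Finset.univ.erase i, inner 𝕜 (x j) (y j) := fun c =>
    Finset.prod_congr rfl fun j hj => by
      rw [Function.update_of_ne (Finset.ne_of_mem_erase hj)]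
  simp only [key, Function.update_self, inner_smul_left, smul_eq_mul, mul_assoc]

/-- The form `(a, b) ↦ ⟪b, a⟫`, linear in `a` and conjugate linear in `b`. -/
noncomputable def AlgTensor.form : AlgTensor 𝕜 E →ₗ[𝕜] (AlgTensor 𝕜 E →ₛₗ[starRingEnd 𝕜] 𝕜) :=
  PiTensorProduct.lift
    { toFun := fun x =>
        { toFun := fun b => starRingEnd 𝕜 (AlgTensor.innerPure x b)
          map_add' := fun b c => by simp
          map_smul' := fun c b => by simp }
      map_update_add' := fun x i a b => by
        ext c
        simp [AlgTensor.innerPure_update_add]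
      map_update_smul' := fun x i a b => by
        ext c
        simp [AlgTensor.innerPure_update_smul] }

theorem AlgTensor.form_pure (x : ∀ i, E i) (b : AlgTensor 𝕜 E) :
    AlgTensor.form (AlgTensor.pure x) b = starRingEnd 𝕜 (AlgTensor.innerPure x b) := by
  unfold AlgTensor.form
  erw [PiTensorProduct.lift.tprod]
  rfl

theorem AlgTensor.form_pure_pure (x y : ∀ i, E i) :
    AlgTensor.form (AlgTensor.pure (𝕜 := 𝕜) x) (AlgTensor.pure y) =
      ∏ i, inner 𝕜 (y i) (x i) := by
  simp [AlgTensor.form_pure, AlgTensor.innerPure_pure]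

theorem AlgTensor.induction {p : AlgTensor 𝕜 E → Prop} (a : AlgTensor 𝕜 E)
    (pure : ∀ x, p (AlgTensor.pure x)) (zero : p 0) (add : ∀ a b, p a → p b → p (a + b))
    (smul : ∀ (c : 𝕜) a, p a → p (c • a)) : p a := by
  have ha : a ∈ Submodule.span 𝕜 (Set.range (AlgTensor.pure : (∀ i, E i) → AlgTensor 𝕜 E)) :=
    AlgTensor.span_pure (E := E) (𝕜 := 𝕜) ▸ trivial
  induction ha using Submodule.span_induction with
  | mem x hx => obtain ⟨y, rfl⟩ := hx; exact pure y
  | zero => exact zero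
  | add a b _ _ h₁ h₂ => exact add a b h₁ h₂
  | smul c a _ h => exact smul c a h

theorem AlgTensor.exists_sum (a : AlgTensor 𝕜 E) :
    ∃ c : (∀ i, E i) →₀ 𝕜, (c.sum fun x r => r • AlgTensor.pure x) = a :=
  Finsupp.mem_span_range_iff_exists_finsupp.1 (AlgTensor.span_pure (E := E) (𝕜 := 𝕜) ▸ trivial)

theorem AlgTensor.form_symm (a b : AlgTensor 𝕜 E) :
    starRingEnd 𝕜 (AlgTensor.form a b) = AlgTensor.form b a := by
  obtain ⟨c, rfl⟩ := AlgTensor.exists_sum a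
  obtain ⟨e, rfl⟩ := AlgTensor.exists_sum b
  simp only [Finsupp.sum, map_sum, LinearMap.sum_apply, map_smul, map_smulₛₗ, LinearMap.smul_apply,
    AlgTensor.form_pure_pure, smul_eq_mul, map_mul, map_prod, inner_conj_symm,
    RCLike.conj_conj, Finset.mul_sum]
  rw [Finset.sum_comm]
  exact Finset.sum_congr rfl fun x _ => Finset.sum_congr rfl fun y _ => by ring

open scoped ComplexOrder in
theorem AlgTensor.prod_gram_posSemidef (s : Finset ι) {n : Type*} [Fintype n]
    (x : n → ∀ i, E i) :
    (Matrix.of fun k l => ∏ i ∈ s, inner 𝕜 (x k i) (x l i) : Matrix n n 𝕜).PosSemidef := by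
  classical
  induction s using Finset.induction_on with
  | empty =>
    have := Matrix.posSemidef_gram 𝕜 (fun _ : n => (1 : 𝕜))
    convert! this using 1
    ext k l
    simp [Matrix.gram]
  | insert i s hi ih =>
    have := (Matrix.posSemidef_gram 𝕜 (fun k : n => x k i)).hadamard ih
    convert! this using 1
    ext k l
    simp [Matrix.gram, Finset.prod_insert hi, Matrix.hadamard]

open scoped ComplexOrder in
theorem AlgTensor.form_self_nonneg (a : AlgTensor 𝕜 E) : 0 ≤ RCLike.re (AlgTensor.form a a) := by
  obtain ⟨c, rfl⟩ := AlgTensor.exists_sum a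
  have h := (AlgTensor.prod_gram_posSemidef (𝕜 := 𝕜) (E := E) Finset.univ
    (fun k : c.support => (k : ∀ i, E i))).re_dotProduct_nonneg (fun k => c k)
  convert! h using 2
  simp only [Finsupp.sum, map_sum, LinearMap.sum_apply, map_smul, map_smulₛₗ, LinearMap.smul_apply,
    AlgTensor.form_pure_pure, smul_eq_mul, dotProduct, Matrix.mulVec, Matrix.of_apply,
    Finset.mul_sum, Pi.star_apply, RCLike.star_def]
  rw [← Finset.sum_coe_sort]
  refine Finset.sum_congr rfl fun x _ => ?_
  rw [← Finset.sum_coe_sort]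
  exact Finset.sum_congr rfl fun y _ => by ring

/-- The induced (semi-)inner product, `⟪⨂ x i, ⨂ y i⟫ = ∏ i, ⟪x i, y i⟫`. -/
@[reducible] noncomputable def AlgTensor.core : PreInnerProductSpace.Core 𝕜 (AlgTensor 𝕜 E) where
  inner a b := AlgTensor.form b a
  conj_inner_symm a b := AlgTensor.form_symm a b
  re_inner_nonneg a := AlgTensor.form_self_nonneg a
  add_left a b c := by simp
  smul_left a b r := by simp

noncomputable instance AlgTensor.instSeminormedAddCommGroup :
    SeminormedAddCommGroup (AlgTensor 𝕜 E) :=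
  InnerProductSpace.Core.toSeminormedAddCommGroup (c := AlgTensor.core (𝕜 := 𝕜) (E := E))

noncomputable instance AlgTensor.instInnerProductSpace : InnerProductSpace 𝕜 (AlgTensor 𝕜 E) :=
  InnerProductSpace.ofCore AlgTensor.core

theorem AlgTensor.inner_pure_pure (x y : ∀ i, E i) :
    inner 𝕜 (AlgTensor.pure (𝕜 := 𝕜) x) (AlgTensor.pure y) = ∏ i, inner 𝕜 (x i) (y i) :=
  AlgTensor.form_pure_pure y x

/-- The tensor product of the Hilbert spaces `E i`: the Hilbert space completion of the algebraic
tensor product with respect to the induced inner product. -/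
abbrev HilbertTensor (𝕜 : Type u) [RCLike 𝕜] {ι : Type v} [Fintype ι] (E : ι → Type w)
    [∀ i, NormedAddCommGroup (E i)] [∀ i, InnerProductSpace 𝕜 (E i)] : Type (max u v w) :=
  UniformSpace.Completion (AlgTensor 𝕜 E)

end AlgebraicTensor

section Splitting

universe u v w

variable {𝕜 : Type u} [RCLike 𝕜] {ι : Type v} [Fintype ι] [DecidableEq ι]
variable {E : ι → Type w} [∀ i, NormedAddCommGroup (E i)] [∀ i, InnerProductSpace 𝕜 (E i)]

/-- The partial tensor product over the factors with index in `t`. -/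
abbrev AlgPart (𝕜 : Type u) [RCLike 𝕜] {ι : Type v} (E : ι → Type w)
    [∀ i, NormedAddCommGroup (E i)] [∀ i, InnerProductSpace 𝕜 (E i)] (t : Finset ι) :
    Type (max u v w) :=
  AlgTensor 𝕜 (fun i : {i // i ∈ t} => E i)

/-- The partial Hilbert space tensor product over the factors with index in `t`. -/
abbrev HilbertPart (𝕜 : Type u) [RCLike 𝕜] {ι : Type v} (E : ι → Type w)
    [∀ i, NormedAddCommGroup (E i)] [∀ i, InnerProductSpace 𝕜 (E i)] (t : Finset ι) :
    Type (max u v w) :=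
  HilbertTensor 𝕜 (fun i : {i // i ∈ t} => E i)

/-- The family that agrees with `x` on `t` and with `y` off `t`. -/
def glue (t : Finset ι) (x : ∀ i : {i // i ∈ t}, E i) (y : ∀ i : {i // i ∈ tᶜ}, E i) (i : ι) : E i :=
  if h : i ∈ t then x ⟨i, h⟩ else y ⟨i, Finset.mem_compl.2 h⟩

theorem glue_update_left {t : Finset ι} (x : ∀ i : {i // i ∈ t}, E i)
    (y : ∀ i : {i // i ∈ tᶜ}, E i) (i : {i // i ∈ t}) (a : E i) :
    glue t (Function.update x i a) y = Function.update (glue t x y) i a := by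
  funext j
  by_cases hj : j = i
  · subst hj
    simp [glue]
  · rw [Function.update_of_ne hj]
    unfold glue
    split_ifs with h
    · rw [Function.update_of_ne fun h' => hj (congrArg Subtype.val h')]
    · rfl

theorem glue_update_right {t : Finset ι} (x : ∀ i : {i // i ∈ t}, E i)
    (y : ∀ i : {i // i ∈ tᶜ}, E i) (i : {i // i ∈ tᶜ}) (a : E i) :
    glue t x (Function.update y i a) = Function.update (glue t x y) i a := by
  funext j
  by_cases hj : j = i
  · subst hj
    simp [glue, Finset.mem_compl.1 i.2]
  · rw [Function.update_of_ne hj]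
    unfold glue
    split_ifs with h
    · rfl
    · rw [Function.update_of_ne fun h' => hj (congrArg Subtype.val h')]

theorem prod_glue (t : Finset ι) (x x' : ∀ i : {i // i ∈ t}, E i)
    (y y' : ∀ i : {i // i ∈ tᶜ}, E i) :
    ∏ i, inner 𝕜 (glue t x y i) (glue t x' y' i) =
      (∏ i, inner 𝕜 (x i) (x' i)) * ∏ i, inner 𝕜 (y i) (y' i) := by
  rw [← Finset.prod_mul_prod_compl t, ← Finset.prod_coe_sort t, ← Finset.prod_coe_sort tᶜ]
  congr 1
  · exact Finset.prod_congr rfl fun i _ => by simp [glue]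
  · exact Finset.prod_congr rfl fun i _ => by simp [glue, Finset.mem_compl.1 i.2]

/-- For an elementary tensor `⨂ x i` over `t`, the map `y ↦ (⨂ x i) ⊗ y`. -/
noncomputable def AlgTensor.mulPure (t : Finset ι) (x : ∀ i : {i // i ∈ t}, E i) :
    AlgPart 𝕜 E tᶜ →ₗ[𝕜] AlgTensor 𝕜 E :=
  PiTensorProduct.lift
    { toFun := fun y => AlgTensor.pure (glue t x y)
      map_update_add' := fun y i a b => by
        convert (AlgTensor.pure (𝕜 := 𝕜)).map_update_add (glue t x y) i a b using 2 <;>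
          rw [← glue_update_right] <;> congr!
      map_update_smul' := fun y i c a => by
        convert (AlgTensor.pure (𝕜 := 𝕜)).map_update_smul (glue t x y) i c a using 2 <;>
          rw [← glue_update_right] <;> congr! }

theorem AlgTensor.mulPure_pure (t : Finset ι) (x : ∀ i : {i // i ∈ t}, E i)
    (y : ∀ i : {i // i ∈ tᶜ}, E i) :
    AlgTensor.mulPure (𝕜 := 𝕜) t x (AlgTensor.pure y) = AlgTensor.pure (glue t x y) := by
  unfold AlgTensor.mulPure
  erw [PiTensorProduct.lift.tprod]
  rfl

/-- The tensor multiplication `(x, y) ↦ x ⊗ y` on the algebraic tensor products over `t` and over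
its complement. -/
noncomputable def AlgTensor.mul (t : Finset ι) :
    AlgPart 𝕜 E t →ₗ[𝕜] AlgPart 𝕜 E tᶜ →ₗ[𝕜] AlgTensor 𝕜 E :=
  PiTensorProduct.lift
    { toFun := fun x => AlgTensor.mulPure t x
      map_update_add' := fun x i a b => by
        refine AlgTensor.hom_ext fun y => ?_
        simp only [LinearMap.add_apply, AlgTensor.mulPure_pure]
        convert (AlgTensor.pure (𝕜 := 𝕜)).map_update_add (glue t x y) i a b using 2 <;>
          rw [← glue_update_left] <;> congr!
      map_update_smul' := fun x i c a => by
        refine AlgTensor.hom_ext fun y => ?_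
        simp only [LinearMap.smul_apply, AlgTensor.mulPure_pure]
        convert (AlgTensor.pure (𝕜 := 𝕜)).map_update_smul (glue t x y) i c a using 2 <;>
          rw [← glue_update_left] <;> congr! }

theorem AlgTensor.mul_pure_pure (t : Finset ι) (x : ∀ i : {i // i ∈ t}, E i)
    (y : ∀ i : {i // i ∈ tᶜ}, E i) :
    AlgTensor.mul (𝕜 := 𝕜) t (AlgTensor.pure x) (AlgTensor.pure y) =
      AlgTensor.pure (glue t x y) := by
  rw [← AlgTensor.mulPure_pure]
  unfold AlgTensor.mul
  erw [PiTensorProduct.lift.tprod]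
  rfl

theorem AlgTensor.inner_mul_mul (t : Finset ι) (a a' : AlgPart 𝕜 E t) (b b' : AlgPart 𝕜 E tᶜ) :
    inner 𝕜 (AlgTensor.mul t a b) (AlgTensor.mul t a' b') = inner 𝕜 a a' * inner 𝕜 b b' := by
  induction a using AlgTensor.induction with
  | zero => simp
  | add a₁ a₂ h₁ h₂ => simp only [map_add, LinearMap.add_apply, inner_add_left, h₁, h₂, add_mul]
  | smul c a h => simp only [map_smul, LinearMap.smul_apply, inner_smul_left, h, mul_assoc]
  | pure x =>
  induction a' using AlgTensor.induction with
  | zero => simp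
  | add a₁ a₂ h₁ h₂ => simp only [map_add, LinearMap.add_apply, inner_add_right, h₁, h₂, add_mul]
  | smul c a h => simp only [map_smul, LinearMap.smul_apply, inner_smul_right, h, mul_assoc]
  | pure x' =>
  induction b using AlgTensor.induction with
  | zero => simp
  | add a₁ a₂ h₁ h₂ => simp only [map_add, inner_add_left, h₁, h₂, mul_add]
  | smul c a h => simp only [map_smul, inner_smul_left, h, mul_left_comm]
  | pure y =>
  induction b' using AlgTensor.induction with
  | zero => simp
  | add a₁ a₂ h₁ h₂ => simp only [map_add, inner_add_right, h₁, h₂, mul_add]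
  | smul c a h => simp only [map_smul, inner_smul_right, h, mul_left_comm]
  | pure y' => simp only [AlgTensor.mul_pure_pure, AlgTensor.inner_pure_pure, prod_glue]

theorem AlgTensor.norm_mul (t : Finset ι) (a : AlgPart 𝕜 E t) (b : AlgPart 𝕜 E tᶜ) :
    ‖AlgTensor.mul t a b‖ = ‖a‖ * ‖b‖ := by
  have h := AlgTensor.inner_mul_mul t a a b b
  simp only [inner_self_eq_norm_sq_to_K] at h
  have h' : ‖AlgTensor.mul t a b‖ ^ 2 = (‖a‖ * ‖b‖) ^ 2 := by
    rw [mul_pow]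
    exact_mod_cast h
  exact (pow_left_inj₀ (norm_nonneg _) (by positivity) two_ne_zero).1 h'

/-- `AlgTensor.mul` with values in the Hilbert space tensor product, extended by continuity in the
first argument. -/
noncomputable def HilbertTensor.mulAux (t : Finset ι) :
    HilbertPart 𝕜 E t →L[𝕜] AlgPart 𝕜 E tᶜ →L[𝕜] HilbertTensor 𝕜 E :=
  (LinearMap.mkContinuous₂
    ((AlgTensor.mul t).compr₂ (UniformSpace.Completion.toComplL (𝕜 := 𝕜)
      (E := AlgTensor 𝕜 E)).toLinearMap) 1
    (fun a b => by simp [AlgTensor.norm_mul])).extend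
    (UniformSpace.Completion.toComplL (𝕜 := 𝕜) (E := AlgPart 𝕜 E t))

/-- The tensor multiplication `(x, y) ↦ x ⊗ y` from the Hilbert space tensor products over `t` and
over its complement to the full one; the unique continuous bilinear extension of the algebraic
one. -/
noncomputable def HilbertTensor.mul (t : Finset ι) :
    HilbertPart 𝕜 E t →L[𝕜] HilbertPart 𝕜 E tᶜ →L[𝕜] HilbertTensor 𝕜 E :=
  ((HilbertTensor.mulAux t).flip.extend
    (UniformSpace.Completion.toComplL (𝕜 := 𝕜) (E := AlgPart 𝕜 E tᶜ))).flip

/-- The Hilbert--Schmidt operator associated with `v` for the splitting `t`, `tᶜ`: it sends `y` to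
the unique element `z` of the tensor product over `t` with `⟪x, z⟫ = ⟪x ⊗ y, v⟫` for all `x`
(so `a ⊗ b` is sent to the operator `y ↦ ⟪y, b⟫ a`). -/
noncomputable def HilbertTensor.unfolding (t : Finset ι) (v : HilbertTensor 𝕜 E) :
    HilbertPart 𝕜 E tᶜ →ₛₗ[starRingEnd 𝕜] HilbertPart 𝕜 E t where
  toFun y := ContinuousLinearMap.adjoint ((HilbertTensor.mul (𝕜 := 𝕜) (E := E) t).flip y) v
  map_add' y z := by simp
  map_smul' c y := by
    rw [map_smul, map_smulₛₗ]
    rfl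

/-- The `t`-rank: the rank, in `ℕ ∪ {∞}`, of the associated Hilbert--Schmidt operator. -/
noncomputable def HilbertTensor.tRank (t : Finset ι) (v : HilbertTensor 𝕜 E) : ℕ∞ :=
  Cardinal.toENat (Module.rank 𝕜 (LinearMap.range (HilbertTensor.unfolding t v)))

/-- The error of best approximation of `u` by tensors of `t`-rank at most `r`. -/
noncomputable def HilbertTensor.approxError (t : Finset ι) (r : ℕ) (u : HilbertTensor 𝕜 E) : ℝ :=
  Metric.infDist u {v | HilbertTensor.tRank t v ≤ r}

/-- The elements of the affine hyperplane `u + ⟨u⟩ᗮ` that have `t`-rank at most one. -/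
def HilbertTensor.rankOneStart (t : Finset ι) (u : HilbertTensor 𝕜 E) :
    Set (HilbertTensor 𝕜 E) :=
  {v | inner 𝕜 (v - u) u = 0 ∧ HilbertTensor.tRank t v ≤ 1}

/-- The distance of `u` to the tensors of `t`-rank at most one in `u + ⟨u⟩ᗮ`. -/
noncomputable def HilbertTensor.rankOneDist (t : Finset ι) (u : HilbertTensor 𝕜 E) : ℝ :=
  Metric.infDist u (HilbertTensor.rankOneStart t u)

/-- `A = ∑ i, B i ⊗ C i`, where `B ⊗ C` is the bounded operator with
`(B ⊗ C) (x ⊗ y) = B x ⊗ C y`; the tensors `x ⊗ y` span a dense subspace. -/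
def HilbertTensor.IsSumTensor (t : Finset ι) (A : HilbertTensor 𝕜 E →L[𝕜] HilbertTensor 𝕜 E)
    {n : ℕ} (B : Fin n → HilbertPart 𝕜 E t →L[𝕜] HilbertPart 𝕜 E t)
    (C : Fin n → HilbertPart 𝕜 E tᶜ →L[𝕜] HilbertPart 𝕜 E tᶜ) : Prop :=
  ∀ x y, A (HilbertTensor.mul t x y) = ∑ i, HilbertTensor.mul t (B i x) (C i y)

end Splitting

/-! Put `D = A - λ₁` and `G = Γ - λ₁`. The gradient step `S = 1 - ω D` with `ω = 2 / (δ + G)` fixes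
`u`, preserves the hyperplane `u + ⟨u⟩ᗮ`, and contracts `⟨u⟩ᗮ` by `(G - δ) / (G + δ) = q`. As a
combination of the identity and `A`, `S` is a sum of `R` elementary operators, so it multiplies the
`t`-rank by at most `R`. Iterating from a rank-one `v` in the hyperplane gives, after `k` steps,
`t`-rank at most `R ^ k` and error at most `q ^ k * ‖v - u‖`. For `R ^ k ≤ r < R ^ (k + 1)` this is
the claimed algebraic rate; the rounding of `r` costs the factor `1 / q`.

The contraction (`norm_sub_smul_le_of_gap`) is obtained from quadratic forms, without spectral
measures. The gap gives `D ^ 2 ≥ δ D` (`mul_re_inner_le_norm_sq_of_gap`), hence `D ≥ δ` on the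
orthogonal complement of the kernel, hence `(D - δ) (D - G) ≤ 0` there. The rank bound is
`tRank_apply_le`. -/

/-! ### Quadratic forms of self-adjoint operators with a spectral gap. -/

section SelfAdjoint

variable {𝕜 : Type*} [RCLike 𝕜] {V : Type*} [NormedAddCommGroup V] [InnerProductSpace 𝕜 V]

/-- Cauchy--Schwarz for the form of `T` and the vectors `x` and `T x`; positivity of the form is
only needed on the real span of these two vectors. -/
theorem LinearMap.IsSymmetric.norm_pow_four_le {T : V →ₗ[𝕜] V} (hT : T.IsSymmetric) (x : V)
    (h : ∀ s : ℝ, 0 ≤ RCLike.re (inner 𝕜 (T (x - (s : 𝕜) • T x)) (x - (s : 𝕜) • T x))) :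
    ‖T x‖ ^ 4 ≤ RCLike.re (inner 𝕜 (T x) x) * RCLike.re (inner 𝕜 (T (T x)) (T x)) := by
  have key : ∀ s : ℝ, 0 ≤ RCLike.re (inner 𝕜 (T (T x)) (T x)) * (s * s) +
      (-2 * ‖T x‖ ^ 2) * s + RCLike.re (inner 𝕜 (T x) x) := by
    intro s
    refine (h s).trans_eq ?_
    have h1 : inner 𝕜 (T (T x)) x = inner 𝕜 (T x) (T x) := hT _ _
    simp only [map_sub, map_smul, inner_sub_left, inner_sub_right, inner_smul_left,
      inner_smul_right, RCLike.conj_ofReal, h1, RCLike.re_ofReal_mul, inner_self_eq_norm_sq]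
    ring
  -- The form along `x - s T x` is a nonnegative real quadratic in `s`, so its discriminant is
  -- nonpositive.
  have := discrim_le_zero key
  unfold discrim at this
  nlinarith

/-- The operator inequality `T ^ 2 ≤ K T` for `0 ≤ T ≤ K`, localized at `x`: bound the second factor
in Cauchy–Schwarz by `K * ‖T x‖ ^ 2` and cancel `‖T x‖ ^ 2`. -/
theorem LinearMap.IsSymmetric.norm_sq_le {T : V →ₗ[𝕜] V} (hT : T.IsSymmetric) (x : V) (K : ℝ)
    (h : ∀ s : ℝ, 0 ≤ RCLike.re (inner 𝕜 (T (x - (s : 𝕜) • T x)) (x - (s : 𝕜) • T x)))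
    (hK : RCLike.re (inner 𝕜 (T (T x)) (T x)) ≤ K * ‖T x‖ ^ 2) :
    ‖T x‖ ^ 2 ≤ K * RCLike.re (inner 𝕜 (T x) x) := by
  have h0 : 0 ≤ RCLike.re (inner 𝕜 (T x) x) := by simpa using h 0
  have h4 := hT.norm_pow_four_le x h
  have h5 := h4.trans (mul_le_mul_of_nonneg_left hK h0)
  rcases (norm_nonneg (T x)).eq_or_lt with h6 | h6
  · have : T x = 0 := norm_eq_zero.1 h6.symm
    simp [this]
  · have h7 : 0 < ‖T x‖ ^ 2 := by positivity
    refine le_of_mul_le_mul_right ?_ h7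
    calc _ = ‖T x‖ ^ 4 := by ring
      _ ≤ _ := h5
      _ = _ := by ring

/-- A positive invertible operator is coercive. -/
theorem ContinuousLinearMap.exists_coercive_of_isUnit {T : V →L[𝕜] V}
    (hT : (T : V →ₗ[𝕜] V).IsSymmetric) (h0 : ∀ x, 0 ≤ RCLike.re (inner 𝕜 (T x) x))
    (hu : IsUnit T) : ∃ ε > 0, ∀ x, ε * ‖x‖ ^ 2 ≤ RCLike.re (inner 𝕜 (T x) x) := by
  obtain ⟨S, hS⟩ := hu.exists_left_inv
  refine ⟨1 / (‖S‖ ^ 2 * ‖T‖ + 1), by positivity, fun x => ?_⟩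
  have hx : S (T x) = x := by
    have := DFunLike.congr_fun hS x
    simpa using this
  have h1 : ‖x‖ ≤ ‖S‖ * ‖T x‖ := by
    conv_lhs => rw [← hx]
    exact S.le_opNorm _
  have h2 : ‖T x‖ ^ 2 ≤ ‖T‖ * RCLike.re (inner 𝕜 (T x) x) := by
    refine hT.norm_sq_le x ‖T‖ (fun s => h0 _) ?_
    refine (re_inner_le_norm _ _).trans ?_
    have := mul_le_mul_of_nonneg_right (T.le_opNorm (T x)) (norm_nonneg (T x))
    exact this.trans_eq (by simp; ring)
  have h3 : ‖x‖ ^ 2 ≤ ‖S‖ ^ 2 * (‖T‖ * RCLike.re (inner 𝕜 (T x) x)) :=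
    calc ‖x‖ ^ 2 ≤ (‖S‖ * ‖T x‖) ^ 2 := by gcongr
      _ = ‖S‖ ^ 2 * ‖T x‖ ^ 2 := by ring
      _ ≤ _ := by gcongr
  rw [div_mul_eq_mul_div, one_mul, div_le_iff₀ (by positivity)]
  linarith [h0 x]

/-- If `(0, δ)` does not meet the spectrum of the symmetric operator `D`, then `D ^ 2 ≥ δ D`. -/
theorem ContinuousLinearMap.mul_re_inner_le_norm_sq_of_gap [Nontrivial V] {D : V →L[𝕜] V}
    (hD : (D : V →ₗ[𝕜] V).IsSymmetric) {δ : ℝ} (hδ : 0 < δ)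
    (hgap : ∀ r : ℝ, 0 < r → r < δ → IsUnit (D - (r : 𝕜) • (1 : V →L[𝕜] V))) (x : V) :
    δ * RCLike.re (inner 𝕜 (D x) x) ≤ ‖D x‖ ^ 2 := by
  -- The lower bounds of the form of `D ^ 2 - δ D`. If their maximum `m` were negative, `D ^ 2 - δ D
  -- - m` would be positive and also invertible, hence coercive, and `m` could be raised.
  set S : Set ℝ := {c | ∀ x, c * ‖x‖ ^ 2 ≤ ‖D x‖ ^ 2 - δ * RCLike.re (inner 𝕜 (D x) x)} with hS
  suffices h : (0 : ℝ) ∈ S by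
    have := h x
    linarith
  by_contra hneg
  have hmono : ∀ c ∈ S, ∀ c' ≤ c, c' ∈ S := fun c hc c' hc' x =>
    (mul_le_mul_of_nonneg_right hc' (by positivity)).trans (hc x)
  have hub : ∀ c ∈ S, c ≤ 0 := fun c hc => le_of_not_gt fun h => hneg (hmono c hc 0 h.le)
  -- Completing the square: `t ^ 2 - δ t ≥ -δ ^ 2 / 4`. The same bound on `m` later makes the roots
  -- of `t ^ 2 - δ t - m` real.
  have hlow : -(δ ^ 2 / 4) ∈ S := by
    intro x
    have h1 : 0 ≤ ‖D x - ((δ / 2 : ℝ) : 𝕜) • x‖ ^ 2 := by positivity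
    rw [@norm_sub_sq 𝕜, inner_smul_right, RCLike.re_ofReal_mul, norm_smul, RCLike.norm_ofReal,
      mul_pow, sq_abs] at h1
    nlinarith
  have hbdd : BddAbove S := ⟨0, fun c hc => hub c hc⟩
  set m := sSup S with hm
  have hmS : m ∈ S := by
    intro x
    rcases eq_or_ne x 0 with rfl | hx
    · simp
    have hx' : 0 < ‖x‖ ^ 2 := by positivity
    rw [← le_div_iff₀ hx']
    exact csSup_le ⟨_, hlow⟩ fun c hc => (le_div_iff₀ hx').2 (hc x)
  have hm0 : m < 0 := lt_of_le_of_ne (hub m hmS) fun h => hneg (h ▸ hmS)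
  have hmlow : -(δ ^ 2 / 4) ≤ m := le_csSup hbdd hlow
  set w := √(δ ^ 2 + 4 * m) with hw
  have hw2 : w ^ 2 = δ ^ 2 + 4 * m := Real.sq_sqrt (by linarith)
  have hw0 : 0 ≤ w := Real.sqrt_nonneg _
  -- Here `m < 0` enters: it puts both roots `(δ ± w) / 2` strictly inside the gap `(0, δ)`, so both
  -- factors of `T` are invertible.
  have hwδ : w < δ := by nlinarith
  set T : V →L[𝕜] V := (D - (((δ - w) / 2 : ℝ) : 𝕜) • (1 : V →L[𝕜] V)) *
    (D - (((δ + w) / 2 : ℝ) : 𝕜) • (1 : V →L[𝕜] V)) with hT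
  have hTu : IsUnit T := (hgap _ (by linarith) (by linarith)).mul (hgap _ (by linarith) (by linarith))
  have hTx : ∀ x, T x = D (D x) - (δ : 𝕜) • D x - (m : 𝕜) • x := by
    intro x
    have e : m = -((δ - w) / 2 * ((δ + w) / 2)) := by linarith
    rw [e]
    simp only [hT, mul_apply_eq_comp, sub_apply,
      smul_apply, one_apply_eq_self, map_sub, map_smul]
    push_cast
    module
  have hD' : ∀ x y, inner 𝕜 (D x) y = inner 𝕜 x (D y) := hD
  have hTs : (T : V →ₗ[𝕜] V).IsSymmetric := by
    intro x y
    simp only [ContinuousLinearMap.coe_coe, hTx, inner_sub_left, inner_sub_right, inner_smul_left,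
      inner_smul_right, RCLike.conj_ofReal, hD']
  have hTq : ∀ x, RCLike.re (inner 𝕜 (T x) x) =
      ‖D x‖ ^ 2 - δ * RCLike.re (inner 𝕜 (D x) x) - m * ‖x‖ ^ 2 := by
    intro x
    rw [hTx, inner_sub_left, inner_sub_left, hD' (D x) x, inner_smul_left, inner_smul_left]
    simp only [RCLike.conj_ofReal, map_sub, RCLike.re_ofReal_mul, inner_self_eq_norm_sq]
  obtain ⟨ε, hε, hc⟩ := ContinuousLinearMap.exists_coercive_of_isUnit hTs
    (fun x => by rw [hTq]; linarith [hmS x]) hTu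
  have : m + ε ∈ S := fun x => by
    have := hc x
    rw [hTq] at this
    linarith
  linarith [le_csSup hbdd this]

/-- The lower bound `δ` for a positive operator with spectral gap `(0, δ)` off its kernel. -/
theorem ContinuousLinearMap.mul_norm_sq_le_of_gap [CompleteSpace V] [Nontrivial V]
    {D : V →L[𝕜] V} (hD : IsSelfAdjoint D) (h0 : ∀ x, 0 ≤ RCLike.re (inner 𝕜 (D x) x))
    {δ : ℝ} (hδ : 0 < δ)
    (hgap : ∀ r : ℝ, 0 < r → r < δ → IsUnit (D - (r : 𝕜) • (1 : V →L[𝕜] V)))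
    {x : V} (hx : x ∈ (D : V →ₗ[𝕜] V).kerᗮ) : δ * ‖x‖ ^ 2 ≤ RCLike.re (inner 𝕜 (D x) x) := by
  have hs := hD.isSymmetric
  -- For self-adjoint `D` this complement is the closure of the range, and the inequality is a
  -- closed condition, so vectors `D y` suffice.
  rw [ContinuousLinearMap.orthogonal_ker, hD.adjoint_eq] at hx
  have hcl : IsClosed {x : V | δ * ‖x‖ ^ 2 ≤ RCLike.re (inner 𝕜 (D x) x)} :=
    isClosed_le (by fun_prop) (RCLike.continuous_re.comp (by fun_prop))
  refine closure_minimal ?_ hcl hx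
  rintro _ ⟨y, rfl⟩
  simp only [ContinuousLinearMap.coe_coe, Set.mem_ofPred_eq]
  have h4 := hs.norm_pow_four_le y fun s => h0 _
  have h2 := D.mul_re_inner_le_norm_sq_of_gap hs hδ hgap y
  simp only [ContinuousLinearMap.coe_coe] at h4
  have h3 := h0 (D y)
  rcases (norm_nonneg (D y)).eq_or_lt with h6 | h6
  · have : D y = 0 := norm_eq_zero.1 h6.symm
    simp [this]
  have h7 : 0 < ‖D y‖ ^ 2 := by positivity
  refine le_of_mul_le_mul_left ?_ h7
  -- Cauchy–Schwarz for the form of `D`, then `δ D ≤ D ^ 2` at `y`.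
  calc ‖D y‖ ^ 2 * (δ * ‖D y‖ ^ 2) = δ * ‖D y‖ ^ 4 := by ring
    _ ≤ δ * (RCLike.re (inner 𝕜 (D y) y) * RCLike.re (inner 𝕜 (D (D y)) (D y))) := by gcongr
    _ = δ * RCLike.re (inner 𝕜 (D y) y) * RCLike.re (inner 𝕜 (D (D y)) (D y)) := by ring
    _ ≤ _ := by gcongr

/-- The contraction factor of the gradient step with optimal step size. -/
theorem ContinuousLinearMap.norm_sub_smul_le_of_gap [CompleteSpace V] [Nontrivial V]
    {D : V →L[𝕜] V} (hD : IsSelfAdjoint D) (h0 : ∀ x, 0 ≤ RCLike.re (inner 𝕜 (D x) x))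
    {δ G : ℝ} (hδ : 0 < δ) (hδG : δ ≤ G)
    (hG : ∀ x, RCLike.re (inner 𝕜 (D x) x) ≤ G * ‖x‖ ^ 2)
    (hgap : ∀ r : ℝ, 0 < r → r < δ → IsUnit (D - (r : 𝕜) • (1 : V →L[𝕜] V)))
    {x : V} (hx : x ∈ (D : V →ₗ[𝕜] V).kerᗮ) :
    ‖x - ((2 / (δ + G) : ℝ) : 𝕜) • D x‖ ≤ (G - δ) / (G + δ) * ‖x‖ := by
  have hs := hD.isSymmetric
  have hD' : ∀ x y, inner 𝕜 (D x) y = inner 𝕜 x (D y) := hs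
  -- `K = D - δ` is nonnegative only on `kerᗮ`. That subspace is `K`-invariant, so it contains every
  -- `x - s K x`, the only vectors at which `norm_sq_le` needs positivity.
  set K : V →ₗ[𝕜] V := (D : V →ₗ[𝕜] V) - (δ : 𝕜) • LinearMap.id with hK
  have hKx : ∀ x, K x = D x - (δ : 𝕜) • x := fun x => rfl
  have hKs : K.IsSymmetric := fun x y => by
    simp only [hKx, inner_sub_left, inner_sub_right, inner_smul_left, inner_smul_right,
      RCLike.conj_ofReal, hD']
  have hinv : ∀ y ∈ (D : V →ₗ[𝕜] V).kerᗮ, K y ∈ (D : V →ₗ[𝕜] V).kerᗮ := by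
    intro y hy
    rw [hKx]
    refine Submodule.sub_mem _ ?_ (Submodule.smul_mem _ _ hy)
    intro z hz
    have hz' : D z = 0 := hz
    rw [← hD', hz', inner_zero_left]
  have hKq : ∀ y, RCLike.re (inner 𝕜 (K y) y) = RCLike.re (inner 𝕜 (D y) y) - δ * ‖y‖ ^ 2 := by
    intro y
    rw [hKx, inner_sub_left, inner_smul_left, RCLike.conj_ofReal, map_sub, RCLike.re_ofReal_mul,
      inner_self_eq_norm_sq]
  have h1 := hKs.norm_sq_le x (G - δ)
    (fun s => by
      rw [hKq]
      have := D.mul_norm_sq_le_of_gap hD h0 hδ hgap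
        (Submodule.sub_mem _ hx (Submodule.smul_mem _ (s : 𝕜) (hinv x hx)))
      linarith)
    (by
      rw [hKq]
      linarith [hG (K x)])
  rw [hKq, hKx, @norm_sub_sq 𝕜, inner_smul_right, RCLike.re_ofReal_mul, norm_smul,
    RCLike.norm_ofReal, mul_pow, sq_abs] at h1
  have hpos : 0 < δ + G := by linarith
  refine (sq_le_sq₀ (norm_nonneg _)
    (mul_nonneg (div_nonneg (by linarith) (by linarith)) (norm_nonneg _))).1 ?_
  have hsym : RCLike.re (inner 𝕜 x (D x)) = RCLike.re (inner 𝕜 (D x) x) := by rw [hD']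
  rw [@norm_sub_sq 𝕜, inner_smul_right, RCLike.re_ofReal_mul, norm_smul, RCLike.norm_ofReal,
    mul_pow, sq_abs, hsym, add_comm G δ, mul_pow, div_pow, div_pow]
  set a := RCLike.re (inner 𝕜 (D x) x)
  -- This is `(D - δ) (D - G) ≤ 0` at `x`. With step size `2 / (δ + G)` the terms in `a` cancel
  -- below, leaving `1 - 4 δ G / (δ + G) ^ 2 = ((G - δ) / (G + δ)) ^ 2`.
  have h2 : ‖D x‖ ^ 2 ≤ (δ + G) * a - δ * G * ‖x‖ ^ 2 := by linarith
  have h3 : 2 ^ 2 / (δ + G) ^ 2 * ‖D x‖ ^ 2 ≤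
      2 ^ 2 / (δ + G) ^ 2 * ((δ + G) * a - δ * G * ‖x‖ ^ 2) := by gcongr
  calc _ ≤ ‖x‖ ^ 2 - 2 * (2 / (δ + G) * a) +
      2 ^ 2 / (δ + G) ^ 2 * ((δ + G) * a - δ * G * ‖x‖ ^ 2) := by linarith
    _ = _ := by
      field_simp
      ring

end SelfAdjoint

/-! ### Elementary tensors, unfoldings and the growth of the `t`-rank. -/

section Rank

universe u v w

variable {𝕜 : Type u} [RCLike 𝕜] {ι : Type v} [Fintype ι] [DecidableEq ι]
variable {E : ι → Type w} [∀ i, NormedAddCommGroup (E i)] [∀ i, InnerProductSpace 𝕜 (E i)]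

theorem AlgTensor.denseRange_toComplL {κ : Type*} [Fintype κ] {F : κ → Type*}
    [∀ i, NormedAddCommGroup (F i)] [∀ i, InnerProductSpace 𝕜 (F i)] :
    DenseRange (UniformSpace.Completion.toComplL (𝕜 := 𝕜) (E := AlgTensor 𝕜 F)) :=
  UniformSpace.Completion.denseRange_coe

theorem AlgTensor.isUniformInducing_toComplL {κ : Type*} [Fintype κ] {F : κ → Type*}
    [∀ i, NormedAddCommGroup (F i)] [∀ i, InnerProductSpace 𝕜 (F i)] :
    IsUniformInducing (UniformSpace.Completion.toComplL (𝕜 := 𝕜) (E := AlgTensor 𝕜 F)) :=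
  UniformSpace.Completion.isUniformInducing_coe _

theorem HilbertTensor.mul_coe_coe (t : Finset ι) (a : AlgPart 𝕜 E t) (b : AlgPart 𝕜 E tᶜ) :
    HilbertTensor.mul t (a : HilbertPart 𝕜 E t) (b : HilbertPart 𝕜 E tᶜ) =
      (AlgTensor.mul t a b : HilbertTensor 𝕜 E) := by
  have h1 : HilbertTensor.mulAux t (a : HilbertPart 𝕜 E t) b =
      (AlgTensor.mul t a b : HilbertTensor 𝕜 E) := by
    unfold HilbertTensor.mulAux
    exact DFunLike.congr_fun (ContinuousLinearMap.extend_eq _ AlgTensor.denseRange_toComplL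
      AlgTensor.isUniformInducing_toComplL a) b
  rw [← h1]
  unfold HilbertTensor.mul
  rw [ContinuousLinearMap.flip_apply]
  exact DFunLike.congr_fun (ContinuousLinearMap.extend_eq _ AlgTensor.denseRange_toComplL
    AlgTensor.isUniformInducing_toComplL b) (a : HilbertPart 𝕜 E t)

theorem HilbertTensor.inner_mul_mul (t : Finset ι) (a a' : HilbertPart 𝕜 E t)
    (b b' : HilbertPart 𝕜 E tᶜ) :
    inner 𝕜 (HilbertTensor.mul t a b) (HilbertTensor.mul t a' b') =
      inner 𝕜 a a' * inner 𝕜 b b' := by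
  induction a using UniformSpace.Completion.induction_on with
  | hp => exact isClosed_eq (by fun_prop) (by fun_prop)
  | ih a =>
  induction a' using UniformSpace.Completion.induction_on with
  | hp => exact isClosed_eq (by fun_prop) (by fun_prop)
  | ih a' =>
  induction b using UniformSpace.Completion.induction_on with
  | hp => exact isClosed_eq (by fun_prop) (by fun_prop)
  | ih b =>
  induction b' using UniformSpace.Completion.induction_on with
  | hp => exact isClosed_eq (by fun_prop) (by fun_prop)
  | ih b' =>
  simp only [HilbertTensor.mul_coe_coe, UniformSpace.Completion.inner_coe,
    AlgTensor.inner_mul_mul]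

/-- The tensors `x ⊗ y` span a dense subspace. -/
theorem HilbertTensor.dense_span_mul (t : Finset ι) :
    Dense (Submodule.span 𝕜 (Set.range fun p : HilbertPart 𝕜 E t × HilbertPart 𝕜 E tᶜ =>
      HilbertTensor.mul t p.1 p.2) : Set (HilbertTensor 𝕜 E)) := by
  refine Dense.mono ?_ (UniformSpace.Completion.denseRange_coe (α := AlgTensor 𝕜 E))
  rintro _ ⟨a, rfl⟩
  change (a : HilbertTensor 𝕜 E) ∈ Submodule.span 𝕜 _
  induction a using AlgTensor.induction with
  | zero => rw [UniformSpace.Completion.coe_zero]; exact Submodule.zero_mem _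
  | add a b ha hb => rw [UniformSpace.Completion.coe_add]; exact Submodule.add_mem _ ha hb
  | smul c a ha => rw [UniformSpace.Completion.coe_smul]; exact Submodule.smul_mem _ _ ha
  | pure x =>
    refine Submodule.subset_span ⟨((AlgTensor.pure fun i => x i : AlgPart 𝕜 E t),
      (AlgTensor.pure fun i => x i : AlgPart 𝕜 E tᶜ)), ?_⟩
    simp only [HilbertTensor.mul_coe_coe, AlgTensor.mul_pure_pure]
    congr 2
    funext i
    unfold glue
    split_ifs <;> rfl

theorem HilbertTensor.eq_of_eq_mul {F : Type*} [TopologicalSpace F] [T2Space F] [AddCommGroup F]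
    [Module 𝕜 F] {t : Finset ι} {f g : HilbertTensor 𝕜 E →L[𝕜] F}
    (h : ∀ x y, f (HilbertTensor.mul t x y) = g (HilbertTensor.mul t x y)) : f = g := by
  refine ContinuousLinearMap.ext_on (HilbertTensor.dense_span_mul t) ?_
  rintro _ ⟨p, rfl⟩
  exact h p.1 p.2

theorem HilbertTensor.inner_unfolding (t : Finset ι) (v : HilbertTensor 𝕜 E)
    (x : HilbertPart 𝕜 E t) (y : HilbertPart 𝕜 E tᶜ) :
    inner 𝕜 x (HilbertTensor.unfolding t v y) = inner 𝕜 (HilbertTensor.mul t x y) v :=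
  ContinuousLinearMap.adjoint_inner_right ((HilbertTensor.mul (𝕜 := 𝕜) (E := E) t).flip y) x v

theorem HilbertTensor.unfolding_mul (t : Finset ι) (a : HilbertPart 𝕜 E t)
    (b y : HilbertPart 𝕜 E tᶜ) :
    HilbertTensor.unfolding t (HilbertTensor.mul t a b) y = inner 𝕜 y b • a := by
  refine ext_inner_left 𝕜 fun x => ?_
  rw [HilbertTensor.inner_unfolding, HilbertTensor.inner_mul_mul, inner_smul_right, mul_comm]

/-- The unfolding of `A v` for `A = ∑ i, B i ⊗ C i`. -/
theorem HilbertTensor.IsSumTensor.unfolding_apply {t : Finset ι}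
    {A : HilbertTensor 𝕜 E →L[𝕜] HilbertTensor 𝕜 E} {n : ℕ}
    {B : Fin n → HilbertPart 𝕜 E t →L[𝕜] HilbertPart 𝕜 E t}
    {C : Fin n → HilbertPart 𝕜 E tᶜ →L[𝕜] HilbertPart 𝕜 E tᶜ}
    (h : HilbertTensor.IsSumTensor t A B C) (v : HilbertTensor 𝕜 E) (y : HilbertPart 𝕜 E tᶜ) :
    HilbertTensor.unfolding t (A v) y =
      ∑ i, B i (HilbertTensor.unfolding t v (ContinuousLinearMap.adjoint (C i) y)) := by
  -- For fixed `y` the unfolding is continuous and linear in the tensor, so the identity need only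
  -- be checked on elementary tensors.
  let U (y : HilbertPart 𝕜 E tᶜ) : HilbertTensor 𝕜 E →L[𝕜] HilbertPart 𝕜 E t :=
    ContinuousLinearMap.adjoint ((HilbertTensor.mul t).flip y)
  have hU : ∀ w y, HilbertTensor.unfolding t w y = U y w := fun _ _ => rfl
  have key : (U y).comp A =
      ∑ i, (B i).comp (U (ContinuousLinearMap.adjoint (C i) y)) := by
    refine HilbertTensor.eq_of_eq_mul (t := t) fun a b => ?_
    rw [ContinuousLinearMap.comp_apply, h a b, map_sum]
    simp only [ContinuousLinearMap.comp_apply, sum_apply, ← hU,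
      HilbertTensor.unfolding_mul, map_smul, ContinuousLinearMap.adjoint_inner_left]
  have := DFunLike.congr_fun key v
  simpa only [ContinuousLinearMap.comp_apply, sum_apply, ← hU] using this

theorem Submodule.rank_finset_sup_le {V : Type*} [AddCommGroup V] [Module 𝕜 V] {κ : Type*}
    (s : Finset κ) (W : κ → Submodule 𝕜 V) (c : Cardinal)
    (h : ∀ i, Module.rank 𝕜 (W i) ≤ c) :
    Module.rank 𝕜 (s.sup W : Submodule 𝕜 V) ≤ s.card * c := by
  classical
  induction s using Finset.induction_on with
  | empty => simp
  | insert i s hi ih =>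
    rw [Finset.sup_insert, Finset.card_insert_of_notMem hi, Nat.cast_succ, add_mul, one_mul,
      add_comm]
    exact (Submodule.rank_add_le_rank_add_rank _ _).trans (add_le_add (h i) ih)

/-- The range of the unfolding of `A v` lies in the sum of the `n` images under `B i` of the range
for `v`, and no image has larger rank than that range. -/
theorem HilbertTensor.IsSumTensor.tRank_apply_le {t : Finset ι}
    {A : HilbertTensor 𝕜 E →L[𝕜] HilbertTensor 𝕜 E} {n : ℕ}
    {B : Fin n → HilbertPart 𝕜 E t →L[𝕜] HilbertPart 𝕜 E t}
    {C : Fin n → HilbertPart 𝕜 E tᶜ →L[𝕜] HilbertPart 𝕜 E tᶜ}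
    (h : HilbertTensor.IsSumTensor t A B C) (v : HilbertTensor 𝕜 E) :
    HilbertTensor.tRank t (A v) ≤ n * HilbertTensor.tRank t v := by
  unfold HilbertTensor.tRank
  set W := LinearMap.range (HilbertTensor.unfolding t v) with hW
  have hle : LinearMap.range (HilbertTensor.unfolding t (A v)) ≤
      Finset.univ.sup fun i => W.map (B i : HilbertPart 𝕜 E t →ₗ[𝕜] HilbertPart 𝕜 E t) := by
    rintro _ ⟨y, rfl⟩
    rw [h.unfolding_apply]
    refine Submodule.sum_mem _ fun i _ => ?_
    exact Finset.le_sup (f := fun i => W.map (B i : HilbertPart 𝕜 E t →ₗ[𝕜] HilbertPart 𝕜 E t))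
      (Finset.mem_univ i) ⟨_, ⟨_, rfl⟩, rfl⟩
  have := (Submodule.rank_mono hle).trans
    (Submodule.rank_finset_sup_le _ _ _ fun i => rank_map_le _ W)
  simpa using OrderHomClass.mono Cardinal.toENat this

theorem HilbertTensor.tRank_mul_le_one (t : Finset ι) (a : HilbertPart 𝕜 E t)
    (b : HilbertPart 𝕜 E tᶜ) : HilbertTensor.tRank t (HilbertTensor.mul t a b) ≤ 1 := by
  have hle : LinearMap.range (HilbertTensor.unfolding t (HilbertTensor.mul t a b)) ≤
      Submodule.span 𝕜 {a} := by
    rintro _ ⟨y, rfl⟩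
    rw [HilbertTensor.unfolding_mul]
    exact Submodule.smul_mem _ _ (Submodule.mem_span_singleton_self a)
  have := (Submodule.rank_mono hle).trans ((rank_span_le _).trans_eq (Cardinal.mk_singleton a))
  exact (OrderHomClass.mono Cardinal.toENat this).trans_eq (map_one _)

/-- Elementary tensors span a dense subspace, so one of them is not orthogonal to `u`; a scalar
multiple of it lies in the hyperplane. -/
theorem HilbertTensor.rankOneStart_nonempty (t : Finset ι) {u : HilbertTensor 𝕜 E} (hu : u ≠ 0) :
    (HilbertTensor.rankOneStart t u).Nonempty := by
  obtain ⟨a, b, hab⟩ : ∃ a b, inner 𝕜 (HilbertTensor.mul t a b) u ≠ 0 := by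
    by_contra! hcon
    refine hu ?_
    have : innerSL 𝕜 u = 0 := HilbertTensor.eq_of_eq_mul (t := t) fun a b => by
      rw [innerSL_apply_apply, ← inner_conj_symm, hcon a b]
      simp
    have h := DFunLike.congr_fun this u
    simpa using h
  -- The scalar makes the inner product with `u` equal to `⟪u, u⟫`; it is conjugated because the
  -- first slot is conjugate linear.
  refine ⟨HilbertTensor.mul t
    (starRingEnd 𝕜 (inner 𝕜 u u / inner 𝕜 (HilbertTensor.mul t a b) u) • a) b, ?_,
    HilbertTensor.tRank_mul_le_one _ _ _⟩
  rw [map_smul, smul_apply, inner_sub_left, inner_smul_left, RCLike.conj_conj,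
    div_mul_cancel₀ _ hab, sub_self]

end Rank

/-! ### Iterating the contraction, and the algebraic rate. -/

section Iteration

/-- The exponent `e` is the one with `n ^ e = q⁻¹`, so `r ≤ n ^ (k + 1)` gives `(1 / r) ^ e ≥ q ^ (k
+ 1)`. -/
theorem Real.pow_le_div_mul_rpow {q : ℝ} (hq0 : 0 < q) (hq1 : q < 1) {n : ℕ} (hn : 2 ≤ n)
    {k r : ℕ} (hr1 : 1 ≤ r) (hr : r ≤ n ^ (k + 1)) :
    q ^ k ≤ 1 / q * (1 / (r : ℝ)) ^ |Real.log q / Real.log (n : ℝ)| := by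
  have hn1 : (1 : ℝ) < n := by exact_mod_cast hn
  have hlog : 0 < Real.log n := Real.log_pos hn1
  have hlq : Real.log q < 0 := Real.log_neg hq0 hq1
  set e := |Real.log q / Real.log (n : ℝ)| with he
  have he' : e = -(Real.log q / Real.log n) :=
    abs_of_neg (div_neg_of_neg_of_pos hlq hlog)
  have hne : (n : ℝ) ^ e = q⁻¹ := by
    rw [Real.rpow_def_of_pos (by linarith), he', mul_neg, mul_div_cancel₀ _ hlog.ne', Real.exp_neg,
      Real.exp_log hq0]
  have hr0 : (0 : ℝ) < r := by exact_mod_cast hr1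
  have h1 : (r : ℝ) ^ e ≤ (q⁻¹) ^ (k + 1) := by
    calc (r : ℝ) ^ e ≤ ((n : ℝ) ^ (k + 1)) ^ e :=
          Real.rpow_le_rpow hr0.le (by exact_mod_cast hr) (abs_nonneg _)
      _ = ((n : ℝ) ^ e) ^ (k + 1) := by
          rw [← Real.rpow_natCast, ← Real.rpow_mul (by linarith), mul_comm, Real.rpow_mul
            (by linarith), Real.rpow_natCast]
      _ = _ := by rw [hne]
  rw [one_div (r : ℝ), Real.inv_rpow hr0.le]
  have h2 : q ^ (k + 1) ≤ ((r : ℝ) ^ e)⁻¹ := by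
    rw [le_inv_comm₀ (by positivity) (by positivity), ← inv_pow]
    exact h1
  calc q ^ k = 1 / q * q ^ (k + 1) := by rw [pow_succ]; field_simp
    _ ≤ _ := by gcongr

universe u v w

variable {𝕜 : Type u} [RCLike 𝕜] {ι : Type v} [Fintype ι] [DecidableEq ι]
variable {E : ι → Type w} [∀ i, NormedAddCommGroup (E i)] [∀ i, InnerProductSpace 𝕜 (E i)]

/-- The iterates of a rank-`n` sum of elementary operators that fixes `u` and contracts `u`'s
orthogonal complement approximate `u`. -/
theorem HilbertTensor.IsSumTensor.approxError_le_pow_mul {t : Finset ι}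
    {S : HilbertTensor 𝕜 E →L[𝕜] HilbertTensor 𝕜 E} {n : ℕ}
    {B : Fin n → HilbertPart 𝕜 E t →L[𝕜] HilbertPart 𝕜 E t}
    {C : Fin n → HilbertPart 𝕜 E tᶜ →L[𝕜] HilbertPart 𝕜 E tᶜ}
    (h : HilbertTensor.IsSumTensor t S B C) (hS : IsSelfAdjoint S) {u : HilbertTensor 𝕜 E}
    (hu0 : u ≠ 0) (hu : S u = u) {q : ℝ} (hq : 0 < q)
    (hSq : ∀ x, inner 𝕜 x u = 0 → ‖S x‖ ≤ q * ‖x‖) {k r : ℕ} (hr : n ^ k ≤ r) :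
    HilbertTensor.approxError t r u ≤ q ^ k * HilbertTensor.rankOneDist t u := by
  rw [← div_le_iff₀' (by positivity)]
  refine (Metric.le_infDist (HilbertTensor.rankOneStart_nonempty t hu0)).2 fun v hv => ?_
  rw [div_le_iff₀' (by positivity)]
  -- The `k`-th iterate of `S` from `v`. Orthogonality of the error to `u` is carried along since
  -- the contraction holds only there; self-adjointness of `S` preserves it.
  have key : ∀ k : ℕ, ∃ w, HilbertTensor.tRank t w ≤ (n ^ k : ℕ) ∧ inner 𝕜 (w - u) u = 0 ∧
      ‖w - u‖ ≤ q ^ k * ‖v - u‖ := by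
    intro k
    induction k with
    | zero => exact ⟨v, by simpa using hv.2, hv.1, by simp⟩
    | succ k ih =>
      obtain ⟨w, h1, h2, h3⟩ := ih
      have hw : S w - u = S (w - u) := by rw [map_sub, hu]
      refine ⟨S w, ?_, ?_, ?_⟩
      · refine (h.tRank_apply_le w).trans ((mul_le_mul_right h1 _).trans_eq ?_)
        rw [pow_succ']
        push_cast
        rfl
      · have hs : inner 𝕜 (S (w - u)) u = inner 𝕜 (w - u) (S u) := hS.isSymmetric _ _
        rw [hw, hs, hu, h2]
      · rw [hw, pow_succ', mul_assoc]
        exact (hSq _ h2).trans (by gcongr)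
  obtain ⟨w, h1, -, h3⟩ := key k
  refine (Metric.infDist_le_dist_of_mem (y := w) ?_).trans ?_
  · exact h1.trans (by exact_mod_cast hr)
  · rw [dist_comm u w, dist_comm u v, dist_eq_norm, dist_eq_norm]
    exact h3

theorem HilbertTensor.IsSumTensor.approxError_le_rpow {t : Finset ι}
    {S : HilbertTensor 𝕜 E →L[𝕜] HilbertTensor 𝕜 E} {n : ℕ}
    {B : Fin n → HilbertPart 𝕜 E t →L[𝕜] HilbertPart 𝕜 E t}
    {C : Fin n → HilbertPart 𝕜 E tᶜ →L[𝕜] HilbertPart 𝕜 E tᶜ}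
    (h : HilbertTensor.IsSumTensor t S B C) (hS : IsSelfAdjoint S) {u : HilbertTensor 𝕜 E}
    (hu0 : u ≠ 0) (hu : S u = u) {q : ℝ} (hq : 0 < q) (hq1 : q < 1)
    (hSq : ∀ x, inner 𝕜 x u = 0 → ‖S x‖ ≤ q * ‖x‖) (hn : 2 ≤ n) {r : ℕ} (hr : 1 ≤ r) :
    HilbertTensor.approxError t r u ≤ HilbertTensor.rankOneDist t u / q *
      (1 / (r : ℝ)) ^ |Real.log q / Real.log (n : ℝ)| := by
  obtain ⟨k, hk, hk'⟩ := exists_nat_pow_near (x := r) (y := n) hr (by omega)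
  refine (h.approxError_le_pow_mul hS hu0 hu hq hSq hk).trans ?_
  refine (mul_le_mul_of_nonneg_right (Real.pow_le_div_mul_rpow hq hq1 hn hr hk'.le)
    Metric.infDist_nonneg).trans_eq ?_
  rw [HilbertTensor.rankOneDist]
  ring

/-- The identity is the elementary operator `id ⊗ id`, which costs one extra term: hence `R = rA +
1`. -/
theorem HilbertTensor.IsSumTensor.add_smul {t : Finset ι}
    {A : HilbertTensor 𝕜 E →L[𝕜] HilbertTensor 𝕜 E} {n : ℕ}
    {B : Fin n → HilbertPart 𝕜 E t →L[𝕜] HilbertPart 𝕜 E t}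
    {C : Fin n → HilbertPart 𝕜 E tᶜ →L[𝕜] HilbertPart 𝕜 E tᶜ}
    (h : HilbertTensor.IsSumTensor t A B C) (α β : 𝕜) :
    HilbertTensor.IsSumTensor t (α • (1 : HilbertTensor 𝕜 E →L[𝕜] HilbertTensor 𝕜 E) + β • A)
      (Fin.cons (α • ContinuousLinearMap.id 𝕜 _) fun i => β • B i)
      (Fin.cons (ContinuousLinearMap.id 𝕜 _) C) := by
  intro x y
  simp [Fin.sum_univ_succ, h x y, Finset.smul_sum]

/-- The multiple of `id ⊗ id` merges with the term `id ⊗ C j`, so no term is added and `R = rA`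
suffices. -/
theorem HilbertTensor.IsSumTensor.add_smul_of_left_eq_id {t : Finset ι}
    {A : HilbertTensor 𝕜 E →L[𝕜] HilbertTensor 𝕜 E} {n : ℕ}
    {B : Fin n → HilbertPart 𝕜 E t →L[𝕜] HilbertPart 𝕜 E t}
    {C : Fin n → HilbertPart 𝕜 E tᶜ →L[𝕜] HilbertPart 𝕜 E tᶜ}
    (h : HilbertTensor.IsSumTensor t A B C) (α β : 𝕜) {j : Fin n}
    (hj : B j = ContinuousLinearMap.id 𝕜 _) :
    HilbertTensor.IsSumTensor t (α • (1 : HilbertTensor 𝕜 E →L[𝕜] HilbertTensor 𝕜 E) + β • A)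
      B (fun i => (if i = j then α else 0) • ContinuousLinearMap.id 𝕜 _ + β • C i) := by
  intro x y
  simp only [add_apply, smul_apply, one_apply_eq_self, h x y, Finset.smul_sum, map_add, map_smul,
    Finset.sum_add_distrib, ContinuousLinearMap.id_apply, add_left_inj]
  rw [Finset.sum_eq_single j (fun i _ hij => by simp [hij]) (by simp)]
  simp [hj]

theorem HilbertTensor.IsSumTensor.add_smul_of_right_eq_id {t : Finset ι}
    {A : HilbertTensor 𝕜 E →L[𝕜] HilbertTensor 𝕜 E} {n : ℕ}
    {B : Fin n → HilbertPart 𝕜 E t →L[𝕜] HilbertPart 𝕜 E t}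
    {C : Fin n → HilbertPart 𝕜 E tᶜ →L[𝕜] HilbertPart 𝕜 E tᶜ}
    (h : HilbertTensor.IsSumTensor t A B C) (α β : 𝕜) {j : Fin n}
    (hj : C j = ContinuousLinearMap.id 𝕜 _) :
    HilbertTensor.IsSumTensor t (α • (1 : HilbertTensor 𝕜 E →L[𝕜] HilbertTensor 𝕜 E) + β • A)
      (fun i => (if i = j then α else 0) • ContinuousLinearMap.id 𝕜 _ + β • B i) C := by
  intro x y
  simp only [add_apply, smul_apply, one_apply_eq_self, h x y, Finset.smul_sum, map_add, map_smul,
    Finset.sum_add_distrib, ContinuousLinearMap.id_apply, add_left_inj]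
  rw [Finset.sum_eq_single j (fun i _ hij => by simp [hij]) (by simp)]
  simp [hj]

end Iteration

/-! ### The eigenvector estimate. -/

theorem theorem3 {𝕜 : Type*} [RCLike 𝕜] {d : ℕ} {H : Fin d → Type*}
    [∀ μ, NormedAddCommGroup (H μ)] [∀ μ, InnerProductSpace 𝕜 (H μ)] [∀ μ, CompleteSpace (H μ)]
    (t : Finset (Fin d)) (ht_pos : 0 < t.card) (ht_lt : t.card < d)
    (A : HilbertTensor 𝕜 H →L[𝕜] HilbertTensor 𝕜 H) (hA : IsSelfAdjoint A)
    (rA : ℕ) (hrA : 1 ≤ rA)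
    (B : Fin rA → HilbertPart 𝕜 H t →L[𝕜] HilbertPart 𝕜 H t)
    (C : Fin rA → HilbertPart 𝕜 H tᶜ →L[𝕜] HilbertPart 𝕜 H tᶜ)
    (hABC : HilbertTensor.IsSumTensor t A B C)
    (lam₁ lam₂ Γ δ Δ q : ℝ) (h12 : lam₁ < lam₂) (h2Γ : lam₂ < Γ)
    (hbounds : ∀ v : HilbertTensor 𝕜 H,
      lam₁ * ‖v‖ ^ 2 ≤ RCLike.re (inner 𝕜 v (A v)) ∧
        RCLike.re (inner 𝕜 v (A v)) ≤ Γ * ‖v‖ ^ 2)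
    (u : HilbertTensor 𝕜 H)
    (hu : Module.End.HasEigenvector (A : HilbertTensor 𝕜 H →ₗ[𝕜] HilbertTensor 𝕜 H) (lam₁ : 𝕜) u)
    (hsimple : Module.finrank 𝕜
      (Module.End.eigenspace (A : HilbertTensor 𝕜 H →ₗ[𝕜] HilbertTensor 𝕜 H) (lam₁ : 𝕜)) = 1)
    (hspec : ∀ z ∈ spectrum 𝕜 A, z = (lam₁ : 𝕜) ∨ ∃ x ∈ Set.Icc lam₂ Γ, z = (x : 𝕜))
    (hδ : δ = lam₂ - lam₁) (hΔ : Δ = δ / (Γ - lam₁)) (hq : q = (1 - Δ) / (1 + Δ)) :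
    (HilbertTensor.rankOneStart t u).Nonempty ∧
    (∀ r : ℕ, 1 ≤ r →
      HilbertTensor.approxError t r u ≤
        HilbertTensor.rankOneDist t u / q *
          (1 / (r : ℝ)) ^ |Real.log q / Real.log ((rA : ℝ) + 1)|) ∧
    ((∃ i, B i = ContinuousLinearMap.id 𝕜 _ ∨ C i = ContinuousLinearMap.id 𝕜 _) → 2 ≤ rA →
      ∀ r : ℕ, 1 ≤ r →
        HilbertTensor.approxError t r u ≤
          HilbertTensor.rankOneDist t u / q *
            (1 / (r : ℝ)) ^ |Real.log q / Real.log (rA : ℝ)|) := by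
  have hu0 : u ≠ 0 := hu.2
  have hAu : A u = (lam₁ : 𝕜) • u := hu.apply_eq_smul
  have : Nontrivial (HilbertTensor 𝕜 H) := ⟨u, 0, hu0⟩
  set G := Γ - lam₁ with hG
  have hδ0 : 0 < δ := by linarith
  have hδG : δ < G := by linarith
  have hG0 : 0 < G := by linarith
  have hq' : q = (G - δ) / (G + δ) := by
    rw [hq, hΔ]
    field_simp
  have hq0 : 0 < q := by rw [hq']; exact div_pos (by linarith) (by linarith)
  have hq1 : q < 1 := by rw [hq', div_lt_one (by linarith)]; linarith
  set D : HilbertTensor 𝕜 H →L[𝕜] HilbertTensor 𝕜 H := A - (lam₁ : 𝕜) • 1 with hD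
  have hDx : ∀ x, D x = A x - (lam₁ : 𝕜) • x := fun _ => rfl
  have hsa : ∀ c : ℝ, IsSelfAdjoint ((c : 𝕜) • (1 : HilbertTensor 𝕜 H →L[𝕜] HilbertTensor 𝕜 H)) :=
    fun c => (isSelfAdjoint_iff.2 (RCLike.conj_ofReal c)).smul (IsSelfAdjoint.one _)
  have hDs : IsSelfAdjoint D := hA.sub (hsa _)
  have hDq : ∀ x, RCLike.re (inner 𝕜 (D x) x) =
      RCLike.re (inner 𝕜 x (A x)) - lam₁ * ‖x‖ ^ 2 := by
    intro x
    rw [hDx, inner_sub_left, inner_smul_left, RCLike.conj_ofReal, map_sub, RCLike.re_ofReal_mul,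
      inner_self_eq_norm_sq, inner_re_symm]
  -- For `0 < r < δ` the point `lam₁ + r` lies strictly between `lam₁` and `lam₂`, off the spectrum
  -- of `A`.
  have hgap : ∀ r : ℝ, 0 < r → r < δ →
      IsUnit (D - (r : 𝕜) • (1 : HilbertTensor 𝕜 H →L[𝕜] HilbertTensor 𝕜 H)) := by
    intro r hr0 hrδ
    by_contra hcon
    have hmem : ((lam₁ + r : ℝ) : 𝕜) ∈ spectrum 𝕜 A := by
      rw [spectrum.mem_iff, Algebra.algebraMap_eq_smul_one, ← IsUnit.neg_iff]
      convert hcon using 2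
      rw [hD]
      push_cast
      module
    rcases hspec _ hmem with h | ⟨x, hx, h⟩
    · have := RCLike.ofReal_injective h
      linarith
    · have := RCLike.ofReal_injective h
      linarith [hx.1]
  -- Simplicity of the eigenvalue: the kernel of `D` is the line through `u`.
  have hker : ∀ x, inner 𝕜 x u = 0 →
      x ∈ (D : HilbertTensor 𝕜 H →ₗ[𝕜] HilbertTensor 𝕜 H).kerᗮ := by
    intro x hx z hz
    have hz' : z ∈ Module.End.eigenspace
        (A : HilbertTensor 𝕜 H →ₗ[𝕜] HilbertTensor 𝕜 H) (lam₁ : 𝕜) :=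
      Module.End.mem_eigenspace_iff.2 (sub_eq_zero.1 hz)
    obtain ⟨c, hc⟩ := (finrank_eq_one_iff_of_nonzero'
      (⟨u, hu.1⟩ : Module.End.eigenspace
        (A : HilbertTensor 𝕜 H →ₗ[𝕜] HilbertTensor 𝕜 H) (lam₁ : 𝕜))
      fun h => hu0 (congrArg Subtype.val h)).1 hsimple ⟨z, hz'⟩
    have hc' : c • u = z := congrArg Subtype.val hc
    rw [← hc', inner_smul_left, ← inner_conj_symm, hx, map_zero, mul_zero]
  set ω : ℝ := 2 / (δ + G) with hω
  -- The coefficients for which `α + β A = 1 - ω (A - lam₁)`.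
  set α : 𝕜 := ((1 + ω * lam₁ : ℝ) : 𝕜) with hα
  set β : 𝕜 := ((-ω : ℝ) : 𝕜) with hβ
  set S : HilbertTensor 𝕜 H →L[𝕜] HilbertTensor 𝕜 H := α • 1 + β • A with hS
  have hSx : ∀ x, S x = x - (ω : 𝕜) • D x := by
    intro x
    have : S x = α • x + β • A x := rfl
    rw [this, hDx, hα, hβ]
    push_cast
    module
  have hSs : IsSelfAdjoint S :=
    (hsa _).add ((isSelfAdjoint_iff.2 (RCLike.conj_ofReal (-ω))).smul hA)
  have hSu : S u = u := by rw [hSx, hDx, hAu, sub_self, smul_zero, sub_zero]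
  have hSq : ∀ x, inner 𝕜 x u = 0 → ‖S x‖ ≤ q * ‖x‖ := by
    intro x hx
    rw [hSx, hq']
    exact D.norm_sub_smul_le_of_gap hDs
      (fun y => by rw [hDq]; linarith [(hbounds y).1]) hδ0 hδG.le
      (fun y => by rw [hDq, hG, sub_mul]; linarith [(hbounds y).2]) hgap (hker x hx)
  refine ⟨HilbertTensor.rankOneStart_nonempty t hu0, fun r hr => ?_, ?_⟩
  · have := (hABC.add_smul α β).approxError_le_rpow hSs hu0 hSu hq0 hq1 hSq (by omega) hr
    rwa [Nat.cast_succ] at this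
  · rintro ⟨j, hj | hj⟩ hrA2 r hr
    · exact (hABC.add_smul_of_left_eq_id α β hj).approxError_le_rpow hSs hu0 hSu hq0 hq1 hSq hrA2 hr
    · exact (hABC.add_smul_of_right_eq_id α β hj).approxError_le_rpow hSs hu0 hSu hq0 hq1 hSq
        hrA2 hr
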